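/- Let $d \ge 0$ be an integer, $\mathcal{X} = \{-1,1\}^d$, and let $\mathcal{F}^{\oplus} = \{f_S : S \subseteq [d]\}$, where $f_S(x) = \prod_{i \in S} x_i$, be the class of parities. For a class $\mathcal{F}$ of functions $\mathcal{X} \to \mathbb{R}$, $f^\star \in \mathcal{F}$ and $\varepsilon \ge 0$, let $\underline{\mathsf{Edim}}_{f^\star}(\mathcal{F},\varepsilon)$ be the largest $m$ (or $\infty$) for which there are $(x_1,f_1),\dots,(x_m,f_m) \in \mathcal{X}\times\mathcal{F}$ with $$|f_i(x_i)-f^\star(x_i)|>\varepsilon \quad\text{and}\quad \sum_{j<i}(f_i(x_j)-f^\star(x_j))^2\le\varepsilon^2 \qquad\text{for all } i\in[m].$$ Define $\underline{\mathsf{Sdim}}_{f^\star}(\mathcal{F},\varepsilon)$ in the same way with $\sum_{j\ne i}$ in place of $\sum_{j<i}$. The exact eluder dimension and the exact star number are $\underline{\mathsf{Edim}}(\mathcal{F},\varepsilon)=\sup_{f^\star\in\mathcal{F}}\underline{\mathsf{Edim}}_{f^\star}(\mathcal{F},\varepsilon)$ and $\underline{\mathsf{Sdim}}(\mathcal{F},\varepsilon)=\sup_{f^\star\in\mathcal{F}}\underline{\mathsf{Sdim}}_{f^\star}(\mathcal{F},\varepsilon)$;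 the eluder dimension is $\mathsf{Edim}(\mathcal{F},\varepsilon)=\sup_{f^\star\in\mathcal{F}}\sup_{\varepsilon'\ge\varepsilon}\underline{\mathsf{Edim}}_{f^\star}(\mathcal{F},\varepsilon')$ for $\varepsilon > 0$. For $\sigma:\mathbb{R}\to\mathbb{R}$ and $R>0$, the $\sigma$-rank $\sigma\text{-}\mathsf{rk}(\mathcal{F},R)$ is the smallest $k$ (or $\infty$ if there is none) for which there are maps $\phi:\mathcal{X}\to\{v\in\mathbb{R}^k:\|v\|_2\le 1\}$ and $w:\mathcal{F}\to\{v\in\mathbb{R}^k:\|v\|_2\le R\}$ with $f(x)=\sigma(\langle w(f),\phi(x)\rangle)$ for all $x \in \mathcal{X}$, $f \in \mathcal{F}$. Let $\mathcal{M}_0$ be the set of all $\sigma$ with $0\le\frac{\sigma(z')-\sigma(z)}{z'-z}\le 1$ for all $z<z'$, and let $\mathcal{M}_0\text{-}\mathsf{rk}(\mathcal{F},R)=\min_{\sigma\in\mathcal{M}_0}\sigma\text{-}\mathsf{rk}(\mathcal{F},R)$. Then: (i) $\mathcal{M}_0\text{-}\mathsf{rk}(\mathcal{F}^{\oplus},R)\ge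 2^{d/2}-1$ for all $R>0$. (ii) $\underline{\mathsf{Sdim}}(\mathcal{F}^{\oplus},\varepsilon)\le\underline{\mathsf{Edim}}(\mathcal{F}^{\oplus},\varepsilon)\le d$ for all $\varepsilon\ge 0$. (iii) Consequently the eluder dimension can be exponentially smaller than the $\sigma$-rank for every monotone activation: for every nondecreasing $\sigma:\mathbb{R}\to\mathbb{R}$, all $R>0$ and all $\varepsilon>0$, $\mathsf{Edim}(\mathcal{F}^{\oplus},\varepsilon)\le d$ while $\sigma\text{-}\mathsf{rk}(\mathcal{F}^{\oplus},R)\ge 2^{d/2}-1$. -/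

import Mathlib

open scoped ENNReal

namespace EluderRank

noncomputable section

/-! ### Exact eluder dimension and exact star number -/

/-- The sequence `(x₁, f₁), …, (xₘ, fₘ) ∈ 𝒳 × ℱ` is an eluder sequence for `fstar` at scale `ε`. -/
def IsEluderSeq {X : Type*} (F : Set (X → ℝ)) (fstar : X → ℝ) (ε : ℝ) {m : ℕ}
    (x : Fin m → X) (f : Fin m → X → ℝ) : Prop :=
  ∀ i : Fin m, f i ∈ F ∧ ε < |f i (x i) - fstar (x i)| ∧
    ∑ j ∈ Finset.univ.filter (fun j => j < i), (f i (x j) - fstar (x j)) ^ 2 ≤ ε ^ 2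

/-- The sequence `(x₁, f₁), …, (xₘ, fₘ) ∈ 𝒳 × ℱ` is a star sequence for `fstar` at scale `ε`. -/
def IsStarSeq {X : Type*} (F : Set (X → ℝ)) (fstar : X → ℝ) (ε : ℝ) {m : ℕ}
    (x : Fin m → X) (f : Fin m → X → ℝ) : Prop :=
  ∀ i : Fin m, f i ∈ F ∧ ε < |f i (x i) - fstar (x i)| ∧
    ∑ j ∈ Finset.univ.filter (fun j => j ≠ i), (f i (x j) - fstar (x j)) ^ 2 ≤ ε ^ 2

/-- Exact eluder dimension with respect to `fstar`: the largest length of an eluder sequence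
(`⊤` if there are arbitrarily long ones). -/
def exactEluderDimAt {X : Type*} (F : Set (X → ℝ)) (fstar : X → ℝ) (ε : ℝ) : ℕ∞ :=
  sSup {n : ℕ∞ | ∃ m : ℕ, n = m ∧
    ∃ (x : Fin m → X) (f : Fin m → X → ℝ), IsEluderSeq F fstar ε x f}

/-- Exact star number with respect to `fstar`: the largest length of a star sequence
(`⊤` if there are arbitrarily long ones). -/
def exactStarNumAt {X : Type*} (F : Set (X → ℝ)) (fstar : X → ℝ) (ε : ℝ) : ℕ∞ :=
  sSup {n : ℕ∞ | ∃ m : ℕ, n = m ∧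
    ∃ (x : Fin m → X) (f : Fin m → X → ℝ), IsStarSeq F fstar ε x f}

/-- Exact eluder dimension of a class: supremum over `fstar ∈ F`. -/
def exactEluderDim {X : Type*} (F : Set (X → ℝ)) (ε : ℝ) : ℕ∞ :=
  ⨆ fstar ∈ F, exactEluderDimAt F fstar ε

/-- Exact star number of a class: supremum over `fstar ∈ F`. -/
def exactStarNum {X : Type*} (F : Set (X → ℝ)) (ε : ℝ) : ℕ∞ :=
  ⨆ fstar ∈ F, exactStarNumAt F fstar ε

/-- Eluder dimension of a class: supremum over `fstar ∈ F` and over all scales `ε' ≥ ε` of the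
exact eluder dimension. -/
def eluderDim {X : Type*} (F : Set (X → ℝ)) (ε : ℝ) : ℕ∞ :=
  ⨆ fstar ∈ F, ⨆ ε' ∈ Set.Ici ε, exactEluderDimAt F fstar ε'

/-! ### Generalized rank -/

/-- `F` is realized by generalized linear functions in dimension `k` with activation `σ` at
scale `R`. -/
def IsRealizable {X : Type*} (σ : ℝ → ℝ) (F : Set (X → ℝ)) (R : ℝ) (k : ℕ) : Prop :=
  ∃ (φ : X → Metric.closedBall (0 : EuclideanSpace ℝ (Fin k)) 1)
    (w : F → Metric.closedBall (0 : EuclideanSpace ℝ (Fin k)) R),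
    ∀ (x : X) (f : F), (f : X → ℝ) x =
      σ (inner ℝ (w f : EuclideanSpace ℝ (Fin k)) (φ x : EuclideanSpace ℝ (Fin k)))

/-- The `σ`-rank of `F` at scale `R`: the least possible dimension (`⊤` if there is none). -/
def sigmaRank {X : Type*} (σ : ℝ → ℝ) (F : Set (X → ℝ)) (R : ℝ) : ℕ∞ :=
  sInf {n : ℕ∞ | ∃ k : ℕ, n = k ∧ IsRealizable σ F R k}

/-- The `Σ`-rank of `F` for a collection of activations. -/
def activationRank {X : Type*} (A : Set (ℝ → ℝ)) (F : Set (X → ℝ)) (R : ℝ) : ℕ∞ :=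
  ⨅ σ ∈ A, sigmaRank σ F R

/-- The class of activations all of whose difference quotients lie in `[μ, L]`. -/
def monotoneActivations (μ L : ℝ) : Set (ℝ → ℝ) :=
  {σ | ∀ z z' : ℝ, z < z' →
    μ ≤ (σ z' - σ z) / (z' - z) ∧ (σ z' - σ z) / (z' - z) ≤ L}

/-! ### Parities -/

/-- The parity `x ↦ ∏_{i ∈ S} x i` on `{-1, 1}^d`; the two units of `ℤ` are `1` and `-1`. -/
def parity {d : ℕ} (S : Finset (Fin d)) : (Fin d → ℤˣ) → ℝ :=
  fun x => ∏ i ∈ S, (((x i : ℤˣ) : ℤ) : ℝ)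

/-- The class of all parities over `d` bits. -/
def parityClass (d : ℕ) : Set ((Fin d → ℤˣ) → ℝ) :=
  Set.range (fun S : Finset (Fin d) => parity S)

end

end EluderRank

/-!
The lower bound on the rank is Forster's bound on the sign-rank of a Hadamard matrix. If `σ` is
monotone and realizes the parities in dimension `k`, the arguments at which `σ` takes the value `1`
all lie to the right of those at which it takes the value `-1`. Separating the finitely many
occurring arguments by a threshold, and storing the threshold in one more coordinate, gives vectors
in `ℝᵏ⁺¹` whose inner products have the signs of the `2ᵈ × 2ᵈ` matrix of parities
(`two_pow_le_sq_of_isRealizable`). The rows of that matrix are orthogonal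
(`sum_sq_sum_parity_mul`), so `forster` yields `2ᵈ ≤ (k + 1)²`.

Forster's theorem transforms the row vectors `uₓ` linearly so that their normalizations are
isotropic. Exact isotropy is not needed, and the existence of an optimal transformation is avoided:
the potential `∑ₓ log ‖A uₓ‖² - (N / k) log (det A)²` is bounded below for vectors in general
position, by Hadamard's determinant inequality averaged over all choices of `k` vectors
(`exists_le_scalingPotential`). At a near-minimizer `A`, stretching by a little in any
direction cannot lower the potential by much, which says that the normalized vectors `A uₓ` are
isotropic up to an error (`exists_near_isotropic`). Comparing the resulting lower bound on
`∑ M x y ⟨ûₓ, v̂_y⟩` with the upper bound from the operator norm of `M` gives the theorem as the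
error tends to `0`. General position is reached by a small perturbation along the moment curve.

For the eluder dimension, parities take the values `±1`, so once `ε < 2` the constraints of an
eluder sequence say that `fᵢ` and `f⋆` agree at all earlier points and differ at the `i`-th. Over
`ℤ/2` the product of the `m × d` matrix of the sets and the `d × m` matrix of the points is then
triangular with unit diagonal, whence `m ≤ d` (`le_of_isEluderSeq_parityClass`).
-/

namespace EluderRank

open Matrix Finset Filter Topology

/-! ### Hadamard's inequality and averages over permutations -/

/-- Hadamard's determinant inequality for the rows of a real square matrix. -/
theorem sq_det_le_prod_dotProduct {k : ℕ} (B : Matrix (Fin k) (Fin k) ℝ) :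
    B.det ^ 2 ≤ ∏ i, B i ⬝ᵥ B i := by
  let b := EuclideanSpace.basisFun (Fin k) ℝ
  have : Fact (Module.finrank ℝ (EuclideanSpace ℝ (Fin k)) = k) := ⟨by simp⟩
  let v : Fin k → EuclideanSpace ℝ (Fin k) := fun i => WithLp.toLp 2 (B i)
  have h := b.toBasis.orientation.abs_volumeForm_apply_le v
  rw [b.toBasis.orientation.volumeForm_robust b rfl, Module.Basis.det_apply] at h
  have hB : b.toBasis.toMatrix v = Bᵀ := by
    ext i j
    simp [Module.Basis.toMatrix_apply, b, v]
  rw [hB, det_transpose] at h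
  calc B.det ^ 2 = |B.det| ^ 2 := (sq_abs _).symm
    _ ≤ (∏ i, ‖v i‖) ^ 2 := pow_le_pow_left₀ (abs_nonneg _) h 2
    _ = ∏ i, B i ⬝ᵥ B i := by
      rw [← Finset.prod_pow]
      refine Finset.prod_congr rfl fun i _ => ?_
      rw [EuclideanSpace.real_norm_sq_eq]
      simp [v, dotProduct, sq]

theorem card_mul_sum_perm_apply {X : Type*} [Fintype X] [DecidableEq X] (g : X → ℝ) (a : X) :
    (Fintype.card X : ℝ) * ∑ π : Equiv.Perm X, g (π a) =
      (Fintype.card (Equiv.Perm X) : ℝ) * ∑ x, g x := by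
  have h : ∀ b, ∑ π : Equiv.Perm X, g (π b) = ∑ π : Equiv.Perm X, g (π a) := fun b =>
    Fintype.sum_equiv (Equiv.mulRight (Equiv.swap a b)) _ _ fun π => by simp
  calc (Fintype.card X : ℝ) * ∑ π : Equiv.Perm X, g (π a)
      = ∑ b : X, ∑ π : Equiv.Perm X, g (π b) := by simp [h]
    _ = ∑ π : Equiv.Perm X, ∑ b, g (π b) := Finset.sum_comm
    _ = _ := by simp [Equiv.sum_comp]

/-! ### Near-isotropic position -/

/-- Any `k` of the vectors `u x ∈ ℝᵏ` with distinct indices form a basis. -/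
def InGeneralPosition {X : Type*} {k : ℕ} (u : X → Fin k → ℝ) : Prop :=
  ∀ s : Fin k ↪ X, (Matrix.of fun i => u (s i)).det ≠ 0

/-- The potential `∑ₓ log ‖A uₓ‖² - (N / k) log (det A)²` of an invertible matrix `A`, where `N` is the
number of vectors. It is invariant under scaling `A`, and the vectors `A uₓ / ‖A uₓ‖` are in
isotropic position exactly when `A` is a critical point. -/
noncomputable def scalingPotential {X : Type*} [Fintype X] {k : ℕ} (u : X → Fin k → ℝ)
    (A : Matrix (Fin k) (Fin k) ℝ) : ℝ :=
  ∑ x, Real.log ((A *ᵥ u x) ⬝ᵥ (A *ᵥ u x)) -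
    (Fintype.card X : ℝ) / k * Real.log (A.det ^ 2)

theorem dotProduct_mulVec_self_pos {k : ℕ} {A : Matrix (Fin k) (Fin k) ℝ} (hA : A.det ≠ 0)
    {w : Fin k → ℝ} (hw : w ≠ 0) : 0 < (A *ᵥ w) ⬝ᵥ (A *ᵥ w) := by
  have h : A *ᵥ w ≠ 0 := fun h => hw (Matrix.eq_zero_of_mulVec_eq_zero hA h)
  simpa using Matrix.dotProduct_star_self_pos_iff.mpr h

/-- The potential of vectors in general position is bounded below on invertible matrices: Hadamard's
inequality bounds `det A` by the lengths of any `k` of the vectors `A uₓ`, and averaging over all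
choices of the `k` indices gives every vector the same weight `k / N`. -/
theorem exists_le_scalingPotential {X : Type*} [Fintype X] {k : ℕ} (hk : 0 < k)
    (hkX : k ≤ Fintype.card X) {u : X → Fin k → ℝ} (hgp : InGeneralPosition u)
    (hu : ∀ x, u x ≠ 0) :
    ∃ C : ℝ, ∀ A : Matrix (Fin k) (Fin k) ℝ, A.det ≠ 0 → C ≤ scalingPotential u A := by
  classical
  obtain ⟨s⟩ : Nonempty (Fin k ↪ X) :=
    Function.Embedding.nonempty_of_card_le (by simpa using hkX)
  let U : Equiv.Perm X → Matrix (Fin k) (Fin k) ℝ := fun π => Matrix.of fun i => u (π (s i))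
  have hU : ∀ π, (U π).det ≠ 0 := fun π => hgp (s.trans π.toEmbedding)
  set N : ℝ := (Fintype.card X : ℝ) with hN
  set P : ℝ := (Fintype.card (Equiv.Perm X) : ℝ) with hP
  have hNpos : 0 < N := by
    rw [hN]; exact_mod_cast lt_of_lt_of_le hk hkX
  have hPpos : 0 < P := by
    rw [hP]; exact_mod_cast Fintype.card_pos
  have hkpos : (0 : ℝ) < k := by exact_mod_cast hk
  refine ⟨N / (k * P) * ∑ π, Real.log ((U π).det ^ 2), fun A hA => ?_⟩
  set n : X → ℝ := fun x => (A *ᵥ u x) ⬝ᵥ (A *ᵥ u x) with hn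
  have hnpos : ∀ x, 0 < n x := fun x => dotProduct_mulVec_self_pos hA (hu x)
  -- Hadamard's inequality for the rows `A *ᵥ u (π (s i))`.
  have key : ∀ π, Real.log ((U π).det ^ 2) + Real.log (A.det ^ 2) ≤
      ∑ i, Real.log (n (π (s i))) := by
    intro π
    have h := sq_det_le_prod_dotProduct (U π * Aᵀ)
    have hrow : ∀ i, (U π * Aᵀ) i = A *ᵥ u (π (s i)) := by
      intro i
      rw [Matrix.mul_apply_eq_vecMul, Matrix.vecMul_transpose]
      rfl
    simp only [hrow] at h
    rw [det_mul, det_transpose, mul_pow] at h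
    rw [← Real.log_mul (pow_ne_zero _ (hU π)) (pow_ne_zero _ hA),
      ← Real.log_prod fun i _ => (hnpos _).ne']
    refine Real.log_le_log ?_ h
    have := hU π
    positivity
  have hsum := Finset.sum_le_sum fun π (_ : π ∈ (Finset.univ : Finset (Equiv.Perm X))) => key π
  rw [Finset.sum_add_distrib, Finset.sum_comm] at hsum
  have hav : ∀ i, ∑ π : Equiv.Perm X, Real.log (n (π (s i))) =
      P / N * ∑ x, Real.log (n x) := by
    intro i
    have := card_mul_sum_perm_apply (fun x => Real.log (n x)) (s i)
    field_simp
    linarith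
  simp only [hav, Finset.sum_const, Finset.card_univ, nsmul_eq_mul, Fintype.card_fin] at hsum
  rw [← hP] at hsum
  have hmul := mul_le_mul_of_nonneg_left hsum (show 0 ≤ N / (k * P) by positivity)
  have e1 : N / (k * P) * (k * (P / N * ∑ x, Real.log (n x))) = ∑ x, Real.log (n x) := by
    field_simp
  have e2 : N / (k * P) * (P * Real.log (A.det ^ 2)) = N / k * Real.log (A.det ^ 2) := by
    field_simp
  rw [e1, mul_add, e2] at hmul
  unfold scalingPotential
  linarith

/-- Vectors in general position can be transformed linearly so that their normalizations are isotropic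
up to an error `δ`: a near-minimizer of `scalingPotential` does this, because stretching it along
`v` changes the potential by about
`s (∑ₓ ⟨A uₓ, v⟩² / ‖A uₓ‖² - N / k)` for a small `s`. -/
theorem exists_near_isotropic {X : Type*} [Fintype X] {k : ℕ} (hk : 0 < k)
    (hkX : k ≤ Fintype.card X) {u : X → Fin k → ℝ} (hgp : InGeneralPosition u)
    (hu : ∀ x, u x ≠ 0) {δ : ℝ} (hδ : 0 < δ) :
    ∃ A : Matrix (Fin k) (Fin k) ℝ, A.det ≠ 0 ∧ ∀ v : Fin k → ℝ, v ⬝ᵥ v = 1 →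
      (Fintype.card X : ℝ) / k - δ ≤
        ∑ x, ((A *ᵥ u x) ⬝ᵥ v) ^ 2 / ((A *ᵥ u x) ⬝ᵥ (A *ᵥ u x)) := by
  set c : ℝ := (Fintype.card X : ℝ) / k with hc
  have hc0 : 0 ≤ c := by positivity
  obtain ⟨C, hC⟩ := exists_le_scalingPotential hk hkX hgp hu
  set S : Set ℝ := scalingPotential u '' {A | A.det ≠ 0} with hS
  have hSne : S.Nonempty := ⟨_, 1, by simp, rfl⟩
  have hSbdd : BddBelow S := ⟨C, by rintro _ ⟨A, hA, rfl⟩; exact hC A hA⟩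
  -- With precision `s ^ 2` in the infimum, the final error `s * (c + 1)` is exactly `δ`.
  set s : ℝ := δ / (c + 1) with hs
  have hspos : 0 < s := by positivity
  obtain ⟨_, ⟨A, hA, rfl⟩, hlt⟩ := Real.lt_sInf_add_pos hSne (show 0 < s ^ 2 by positivity)
  refine ⟨A, hA, fun v hv => ?_⟩
  set n : X → ℝ := fun x => (A *ᵥ u x) ⬝ᵥ (A *ᵥ u x) with hn
  have hnpos : ∀ x, 0 < n x := fun x => dotProduct_mulVec_self_pos hA (hu x)
  -- Stretching by `√(1 + s)` in the direction `v` multiplies `(det A)²` by `1 + s`.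
  set t : ℝ := Real.sqrt (1 + s) - 1 with ht
  have ht2 : (1 + t) ^ 2 = 1 + s := by
    rw [ht]; ring_nf; rw [Real.sq_sqrt (by positivity)]
  have htpos : 1 + t ≠ 0 := by
    intro h; rw [h] at ht2; simp at ht2; linarith
  set B : Matrix (Fin k) (Fin k) ℝ := 1 + vecMulVec (t • v) v with hB
  have hBdet : B.det = 1 + t := by
    rw [hB, vecMulVec_eq Unit, det_one_add_replicateCol_mul_replicateRow]
    simp [hv]
  have hBA : (B * A).det ≠ 0 := by
    rw [det_mul, hBdet]; exact mul_ne_zero htpos hA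
  have hnorm : ∀ x, ((B * A) *ᵥ u x) ⬝ᵥ ((B * A) *ᵥ u x) =
      n x * (1 + s * (((A *ᵥ u x) ⬝ᵥ v) ^ 2 / n x)) := by
    intro x
    have e : (B * A) *ᵥ u x = A *ᵥ u x + (t * ((A *ᵥ u x) ⬝ᵥ v)) • v := by
      rw [← mulVec_mulVec, hB, add_mulVec, one_mulVec, vecMulVec_mulVec]
      ext i
      simp [dotProduct_comm v]
      ring
    have hs' : s = t ^ 2 + 2 * t := by linarith
    have := (hnpos x).ne'
    rw [e]
    simp only [add_dotProduct, dotProduct_add, smul_dotProduct, dotProduct_smul, hv,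
      dotProduct_comm v, smul_eq_mul]
    rw [hs']
    field_simp
    ring
  have hle : scalingPotential u A - s ^ 2 ≤ scalingPotential u (B * A) := by
    have := csInf_le hSbdd ⟨B * A, hBA, rfl⟩
    linarith
  have hq : ∀ x, 0 ≤ ((A *ᵥ u x) ⬝ᵥ v) ^ 2 / n x := fun x =>
    div_nonneg (sq_nonneg _) (hnpos x).le
  have hpot : scalingPotential u (B * A) ≤ scalingPotential u A +
      s * ∑ x, ((A *ᵥ u x) ⬝ᵥ v) ^ 2 / n x - c * Real.log (1 + s) := by
    unfold scalingPotential
    rw [det_mul, mul_pow, hBdet, ht2, Real.log_mul (by positivity) (pow_ne_zero _ hA),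
      Finset.mul_sum, ← hc]
    have : ∑ x, Real.log (((B * A) *ᵥ u x) ⬝ᵥ ((B * A) *ᵥ u x)) ≤
        ∑ x, (Real.log (n x) + s * (((A *ᵥ u x) ⬝ᵥ v) ^ 2 / n x)) := by
      refine Finset.sum_le_sum fun x _ => ?_
      have h1 : 0 < 1 + s * (((A *ᵥ u x) ⬝ᵥ v) ^ 2 / n x) := by
        have := hq x; positivity
      rw [hnorm, Real.log_mul (hnpos x).ne' h1.ne']
      have := Real.log_le_sub_one_of_pos h1
      linarith
    rw [Finset.sum_add_distrib] at this
    linarith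
  have hlog : s - s ^ 2 ≤ Real.log (1 + s) := by
    refine le_trans ?_ (Real.one_sub_inv_le_log_of_pos (by positivity))
    have : 1 - (1 + s)⁻¹ - (s - s ^ 2) = s ^ 3 / (1 + s) := by field_simp; ring
    have h3 : 0 ≤ s ^ 3 / (1 + s) := by positivity
    linarith
  have hmain : s * (c - s * (c + 1)) ≤ s * ∑ x, ((A *ᵥ u x) ⬝ᵥ v) ^ 2 / n x := by
    have := mul_le_mul_of_nonneg_left hlog hc0
    nlinarith
  have hδs : s * (c + 1) = δ := by rw [hs]; field_simp
  rw [hδs] at hmain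
  exact le_of_mul_le_mul_left hmain hspos

/-! ### General position by perturbation -/

/-- Points on the moment curve are in general position. -/
theorem exists_inGeneralPosition (X : Type*) [Fintype X] (k : ℕ) :
    ∃ g : X → Fin k → ℝ, InGeneralPosition g := by
  refine ⟨fun x i => (Fintype.equivFin X x : ℕ) ^ (i : ℕ), fun s => ?_⟩
  have : (Matrix.of fun i => fun j : Fin k => ((Fintype.equivFin X (s i) : ℕ) : ℝ) ^ (j : ℕ)) =
      Matrix.vandermonde fun i => ((Fintype.equivFin X (s i) : ℕ) : ℝ) := rfl
  rw [this, Matrix.det_vandermonde_ne_zero_iff]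
  intro i j h
  simpa [Fin.val_inj] using h

theorem eventually_inGeneralPosition_add_smul {X : Type*} [Fintype X] {k : ℕ}
    (u : X → Fin k → ℝ) {g : X → Fin k → ℝ} (hg : InGeneralPosition g) :
    ∀ᶠ t : ℝ in 𝓝[≠] 0, InGeneralPosition fun x => u x + t • g x := by
  classical
  unfold InGeneralPosition
  rw [eventually_all]
  intro s
  -- The minor is a polynomial in `t` with leading coefficient the corresponding minor of `g`.
  let G : Matrix (Fin k) (Fin k) ℝ := Matrix.of fun i => g (s i)
  let V : Matrix (Fin k) (Fin k) ℝ := Matrix.of fun i => u (s i)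
  let p : Polynomial ℝ :=
    ((Polynomial.X : Polynomial ℝ) • G.map Polynomial.C + V.map Polynomial.C).det
  have hp : p ≠ 0 := fun h => hg s <| by
    have := Polynomial.coeff_det_X_add_C_card G V
    change p.coeff _ = _ at this
    rw [h] at this
    simpa using this.symm
  have heval : ∀ t, p.eval t = (Matrix.of fun i => u (s i) + t • g (s i)).det := by
    intro t
    change Polynomial.eval t (det _) = _
    rw [← Polynomial.coe_evalRingHom, RingHom.map_det]
    congr 1
    ext i j
    simp [G, V]
    ring
  have hroots : ∀ᶠ t in 𝓝[≠] (0 : ℝ), ¬ p.IsRoot t :=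
    nhdsNE_le_cofinite 0 ((Polynomial.finite_setOfPred_isRoot hp).subset fun t ht => not_not.1 ht)
  filter_upwards [hroots] with t h h0
  exact h (by rw [Polynomial.IsRoot, heval, h0])

/-! ### Forster's theorem -/

/-- Forster's inequality with an error `δ`, for row vectors in general position. With `a x` and `b y`
the normalized vectors after the transformation of `exists_near_isotropic`, the sum
`∑ M x y ⟨a x, b y⟩` is at least `∑ ⟨a x, b y⟩²`, which near-isotropy bounds below, while the norm
bound on `M` and the Cauchy-Schwarz inequality bound it above. -/
theorem forster_of_inGeneralPosition {X Y : Type*} [Fintype X] [Fintype Y] {k : ℕ} (hk : 0 < k)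
    (hkX : k ≤ Fintype.card X) {M : X → Y → ℝ} (hM : ∀ x y, |M x y| = 1) {C : ℝ}
    (hC : ∀ z : X → ℝ, ∑ y, (∑ x, M x y * z x) ^ 2 ≤ C * ∑ x, z x ^ 2)
    {u : X → Fin k → ℝ} {v : Y → Fin k → ℝ} (hgp : InGeneralPosition u)
    (hsign : ∀ x y, 0 < M x y * (u x ⬝ᵥ v y)) {δ : ℝ} (hδ : 0 < δ)
    (hδle : δ ≤ (Fintype.card X : ℝ) / k) :
    ((Fintype.card Y : ℝ) * ((Fintype.card X : ℝ) / k - δ)) ^ 2 ≤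
      C * Fintype.card X * Fintype.card Y := by
  cases isEmpty_or_nonempty Y with
  | inl hY => simp
  | inr hY =>
  obtain ⟨y₀⟩ := hY
  have hu : ∀ x, u x ≠ 0 := fun x hx => by
    have := hsign x y₀
    simp [hx] at this
  obtain ⟨A, hA, hiso⟩ := exists_near_isotropic hk hkX hgp hu hδ
  set n : X → ℝ := fun x => (A *ᵥ u x) ⬝ᵥ (A *ᵥ u x) with hn
  have hnpos : ∀ x, 0 < n x := fun x => dotProduct_mulVec_self_pos hA (hu x)
  -- The dual vectors move by the inverse transpose, which keeps all the products `⟨uₓ, v_y⟩`.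
  set w : Y → Fin k → ℝ := fun y => (A⁻¹)ᵀ *ᵥ v y with hw
  have huw : ∀ x y, (A *ᵥ u x) ⬝ᵥ w y = u x ⬝ᵥ v y := by
    intro x y
    rw [hw]
    simp only
    rw [mulVec_transpose, dotProduct_comm, ← dotProduct_mulVec, mulVec_mulVec,
      Matrix.nonsing_inv_mul _ (isUnit_iff_ne_zero.2 hA), one_mulVec, dotProduct_comm]
  set p : Y → ℝ := fun y => w y ⬝ᵥ w y with hp
  have hself : ∀ a : Fin k → ℝ, 0 ≤ a ⬝ᵥ a := fun a =>
    Finset.sum_nonneg fun i _ => mul_self_nonneg _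
  have hX : Nonempty X := Fintype.card_pos_iff.1 (lt_of_lt_of_le hk hkX)
  obtain ⟨x₀⟩ := hX
  have hppos : ∀ y, 0 < p y := by
    intro y
    refine lt_of_le_of_ne (hself _) fun h => ?_
    have h0 : w y = 0 := dotProduct_self_eq_zero.1 h.symm
    have := hsign x₀ y
    rw [← huw, h0] at this
    simp at this
  set a : X → Fin k → ℝ := fun x => (√(n x))⁻¹ • (A *ᵥ u x) with ha
  set b : Y → Fin k → ℝ := fun y => (√(p y))⁻¹ • w y with hb
  have ha1 : ∀ x, a x ⬝ᵥ a x = 1 := by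
    intro x
    have h1 : (√(n x)) ^ 2 = n x := Real.sq_sqrt (hnpos x).le
    have h2 : √(n x) ≠ 0 := (Real.sqrt_pos.2 (hnpos x)).ne'
    simp only [ha, smul_dotProduct, dotProduct_smul, smul_eq_mul]
    change _ * (_ * n x) = 1
    field_simp
    rw [h1]
  have hb1 : ∀ y, b y ⬝ᵥ b y = 1 := by
    intro y
    have h1 : (√(p y)) ^ 2 = p y := Real.sq_sqrt (hppos y).le
    have h2 : √(p y) ≠ 0 := (Real.sqrt_pos.2 (hppos y)).ne'
    simp only [hb, smul_dotProduct, dotProduct_smul, smul_eq_mul]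
    change _ * (_ * p y) = 1
    field_simp
    rw [h1]
  have hab : ∀ x y, a x ⬝ᵥ b y = (√(n x))⁻¹ * (√(p y))⁻¹ * (u x ⬝ᵥ v y) := by
    intro x y
    simp only [ha, hb, smul_dotProduct, dotProduct_smul, smul_eq_mul, huw]
    ring
  have hentry : ∀ x y, (a x ⬝ᵥ b y) ^ 2 ≤ M x y * (a x ⬝ᵥ b y) := by
    intro x y
    have hpos : 0 < M x y * (a x ⬝ᵥ b y) := by
      have := hsign x y
      have h1 := Real.sqrt_pos.2 (hnpos x)
      have h2 := Real.sqrt_pos.2 (hppos y)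
      rw [hab, show M x y * ((√(n x))⁻¹ * (√(p y))⁻¹ * (u x ⬝ᵥ v y)) =
        (√(n x))⁻¹ * (√(p y))⁻¹ * (M x y * (u x ⬝ᵥ v y)) by ring]
      positivity
    have habs : M x y * (a x ⬝ᵥ b y) = |a x ⬝ᵥ b y| := by
      rw [← abs_of_pos hpos, abs_mul, hM, one_mul]
    have hcs : (a x ⬝ᵥ b y) ^ 2 ≤ 1 := by
      have := Finset.sum_mul_sq_le_sq_mul_sq Finset.univ (a x) (b y)
      simp only [sq (a x _), sq (b y _)] at this
      change (a x ⬝ᵥ b y) ^ 2 ≤ (a x ⬝ᵥ a x) * (b y ⬝ᵥ b y) at this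
      rwa [ha1, hb1, one_mul] at this
    rw [habs, ← sq_abs]
    have h1 : |a x ⬝ᵥ b y| ≤ 1 := by rwa [← sq_le_one_iff_abs_le_one]
    nlinarith [abs_nonneg (a x ⬝ᵥ b y)]
  have hlow : ∀ y, (Fintype.card X : ℝ) / k - δ ≤ ∑ x, M x y * (a x ⬝ᵥ b y) := by
    intro y
    refine (hiso (b y) (hb1 y)).trans (Finset.sum_le_sum fun x _ => le_trans (le_of_eq ?_)
      (hentry x y))
    simp only [ha, smul_dotProduct, smul_eq_mul, mul_pow, inv_pow]
    rw [Real.sq_sqrt (hnpos x).le, div_eq_inv_mul]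
  set T : ℝ := ∑ y, ∑ x, M x y * (a x ⬝ᵥ b y) with hT
  have hTlow : (Fintype.card Y : ℝ) * ((Fintype.card X : ℝ) / k - δ) ≤ T := by
    simpa using Finset.card_nsmul_le_sum Finset.univ
      (fun y => ∑ x, M x y * (a x ⬝ᵥ b y)) _ fun y _ => hlow y
  have hTeq : T = ∑ q : Fin k × Y, (∑ x, M x q.2 * a x q.1) * b q.2 q.1 := by
    rw [Fintype.sum_prod_type, Finset.sum_comm]
    refine Finset.sum_congr rfl fun y _ => ?_
    simp only [dotProduct, Finset.mul_sum, Finset.sum_mul]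
    rw [Finset.sum_comm]
    exact Finset.sum_congr rfl fun _ _ => Finset.sum_congr rfl fun _ _ => by ring
  have hTup : T ^ 2 ≤ C * Fintype.card X * Fintype.card Y := by
    have h1 : ∑ q : Fin k × Y, (∑ x, M x q.2 * a x q.1) ^ 2 ≤ C * Fintype.card X := by
      rw [Fintype.sum_prod_type]
      calc ∑ c, ∑ y, (∑ x, M x y * a x c) ^ 2
          ≤ ∑ c, C * ∑ x, a x c ^ 2 := Finset.sum_le_sum fun c _ => hC fun x => a x c
        _ = C * ∑ x, a x ⬝ᵥ a x := by
          rw [← Finset.mul_sum, Finset.sum_comm]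
          simp [dotProduct, sq]
        _ = C * Fintype.card X := by simp [ha1]
    have h2 : ∑ q : Fin k × Y, b q.2 q.1 ^ 2 = Fintype.card Y := by
      rw [Fintype.sum_prod_type, Finset.sum_comm]
      calc ∑ y, ∑ c, b y c ^ 2 = ∑ y, b y ⬝ᵥ b y := by simp [dotProduct, sq]
        _ = Fintype.card Y := by simp [hb1]
    rw [hTeq]
    refine (Finset.sum_mul_sq_le_sq_mul_sq _ _ _).trans ?_
    rw [h2]
    exact mul_le_mul_of_nonneg_right h1 (by positivity)
  refine le_trans (pow_le_pow_left₀ ?_ hTlow 2) hTup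
  exact mul_nonneg (by positivity) (by linarith)

/-- **Forster's theorem**: a sign matrix `M` whose squared operator norm is at most `C` has sign-rank at
least `√(|X| |Y| / C)`. -/
theorem forster {X Y : Type*} [Fintype X] [Nonempty X] [Fintype Y] {k : ℕ}
    {M : X → Y → ℝ} (hM : ∀ x y, |M x y| = 1) {C : ℝ}
    (hC : ∀ z : X → ℝ, ∑ y, (∑ x, M x y * z x) ^ 2 ≤ C * ∑ x, z x ^ 2)
    {u : X → Fin k → ℝ} {v : Y → Fin k → ℝ}
    (hsign : ∀ x y, 0 < M x y * (u x ⬝ᵥ v y)) :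
    (Fintype.card X : ℝ) * Fintype.card Y ≤ C * k ^ 2 := by
  classical
  obtain ⟨x₀⟩ := ‹Nonempty X›
  have hCY : (Fintype.card Y : ℝ) ≤ C := by
    have h := hC (Pi.single x₀ 1)
    have h1 : ∀ y, (M x₀ y) ^ 2 = 1 := fun y => by rw [← sq_abs, hM, one_pow]
    simpa [Pi.single_apply, h1, ite_pow] using h
  have hX1 : (1 : ℝ) ≤ Fintype.card X := by
    exact_mod_cast Fintype.card_pos_iff.2 ⟨x₀⟩
  have hC0 : 0 ≤ C := le_trans (by positivity) hCY
  rcases lt_or_ge (Fintype.card X) k with hlt | hkX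
  · have h1 : (Fintype.card X : ℝ) ≤ k := by exact_mod_cast hlt.le
    have h2 : (Fintype.card X : ℝ) ≤ k ^ 2 := by nlinarith
    calc (Fintype.card X : ℝ) * Fintype.card Y ≤ k ^ 2 * C := by gcongr
      _ = C * k ^ 2 := mul_comm _ _
  cases isEmpty_or_nonempty Y with
  | inl hY => simp; positivity
  | inr hY =>
  obtain ⟨y₀⟩ := hY
  have hk : 0 < k := by
    rcases Nat.eq_zero_or_pos k with rfl | h
    · have := hsign x₀ y₀
      simp at this
    · exact h
  obtain ⟨g, hg⟩ := exists_inGeneralPosition X k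
  -- A small perturbation keeps the finitely many strict inequalities.
  have hev : ∀ᶠ t : ℝ in 𝓝[≠] 0, ∀ x y, 0 < M x y * ((u x + t • g x) ⬝ᵥ v y) := by
    refine nhdsWithin_le_nhds ?_
    refine eventually_all.2 fun x => eventually_all.2 fun y => ?_
    have hcont : Continuous fun t : ℝ => M x y * ((u x + t • g x) ⬝ᵥ v y) := by
      simp only [add_dotProduct, smul_dotProduct]
      fun_prop
    exact hcont.continuousAt.eventually (lt_mem_nhds (by simpa using hsign x y))
  obtain ⟨t, hgp, hst⟩ := ((eventually_inGeneralPosition_add_smul u hg).and hev).exists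
  set N : ℝ := (Fintype.card X : ℝ) with hN
  set N' : ℝ := (Fintype.card Y : ℝ) with hN'
  have hkpos : (0 : ℝ) < k := by exact_mod_cast hk
  have hN'pos : 0 < N' := by rw [hN']; exact_mod_cast Fintype.card_pos_iff.2 ⟨y₀⟩
  have hNk : 0 < N / k := by positivity
  have hlim : Tendsto (fun δ : ℝ => (N' * (N / k - δ)) ^ 2) (𝓝[>] 0) (𝓝 ((N' * (N / k - 0)) ^ 2)) :=
    (Continuous.tendsto (by fun_prop) 0).mono_left nhdsWithin_le_nhds
  have hle : (N' * (N / k - 0)) ^ 2 ≤ C * N * N' := by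
    refine le_of_tendsto hlim ?_
    filter_upwards [Ioc_mem_nhdsGT hNk] with δ hδ
    exact forster_of_inGeneralPosition hk hkX hM hC hgp hst hδ.1 hδ.2
  have hpos : 0 < N' * N := by positivity
  have e : (N' * (N / k - 0)) ^ 2 = (N * N') * (N' * N) / k ^ 2 := by field_simp; ring
  rw [e, div_le_iff₀ (by positivity)] at hle
  refine le_of_mul_le_mul_right ?_ hpos
  linarith

/-! ### Eluder sequences and star sequences -/

theorem isEluderSeq_of_isStarSeq {X : Type*} {F : Set (X → ℝ)} {fstar : X → ℝ} {ε : ℝ} {m : ℕ}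
    {x : Fin m → X} {f : Fin m → X → ℝ} (h : IsStarSeq F fstar ε x f) :
    IsEluderSeq F fstar ε x f := by
  intro i
  obtain ⟨h1, h2, h3⟩ := h i
  refine ⟨h1, h2, le_trans (Finset.sum_le_sum_of_subset_of_nonneg ?_ fun _ _ _ => sq_nonneg _) h3⟩
  intro j
  simpa using fun hj : j < i => hj.ne

theorem exactStarNum_le_exactEluderDim {X : Type*} (F : Set (X → ℝ)) (ε : ℝ) :
    exactStarNum F ε ≤ exactEluderDim F ε := by
  refine iSup₂_mono fun fstar _ => sSup_le_sSup ?_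
  rintro n ⟨m, hm, x, f, h⟩
  exact ⟨m, hm, x, f, isEluderSeq_of_isStarSeq h⟩

/-! ### Parities over the field with two elements -/

/-- The isomorphism from the multiplicative group `{1, -1}` to the additive group `ℤ/2`. -/
def unitBit (u : ℤˣ) : ZMod 2 := if u = 1 then 0 else 1

theorem unitBit_mul (a b : ℤˣ) : unitBit (a * b) = unitBit a + unitBit b := by
  revert a b; decide

theorem unitBit_injective : Function.Injective unitBit := by
  intro a b; revert a b; decide

theorem unitBit_prod {ι : Type*} (S : Finset ι) (x : ι → ℤˣ) :
    unitBit (∏ i ∈ S, x i) = ∑ i ∈ S, unitBit (x i) := by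
  classical
  induction S using Finset.induction_on with
  | empty => rfl
  | insert a S ha ih => rw [prod_insert ha, sum_insert ha, unitBit_mul, ih]

theorem parity_eq_prod_units {d : ℕ} (S : Finset (Fin d)) (x : Fin d → ℤˣ) :
    parity S x = (((∏ i ∈ S, x i : ℤˣ) : ℤ) : ℝ) := by
  simp [parity, Units.coe_prod]

theorem parity_eq_or {d : ℕ} (S : Finset (Fin d)) (x : Fin d → ℤˣ) :
    parity S x = 1 ∨ parity S x = -1 := by
  rw [parity_eq_prod_units]
  rcases Int.units_eq_one_or (∏ i ∈ S, x i) with h | h <;> simp [h]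

/-- Two parities agree at `x` exactly when the linear functional over `ℤ/2` given by the sum of
their indicator vectors vanishes at `x`. -/
theorem parity_eq_parity_iff {d : ℕ} (S T : Finset (Fin d)) (x : Fin d → ℤˣ) :
    parity S x = parity T x ↔
      ∑ c, ((if c ∈ S then 1 else 0) + (if c ∈ T then 1 else 0)) * unitBit (x c) = 0 := by
  rw [parity_eq_prod_units, parity_eq_prod_units, Int.cast_inj, Units.val_inj,
    ← unitBit_injective.eq_iff, unitBit_prod, unitBit_prod, ← CharTwo.add_eq_zero]
  simp [add_mul, sum_add_distrib, ite_mul]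

theorem le_of_isEluderSeq_parityClass {d : ℕ} {fstar : (Fin d → ℤˣ) → ℝ}
    (hfstar : fstar ∈ parityClass d) {ε : ℝ} (hε : 0 ≤ ε) {m : ℕ}
    {x : Fin m → Fin d → ℤˣ} {f : Fin m → (Fin d → ℤˣ) → ℝ}
    (h : IsEluderSeq (parityClass d) fstar ε x f) : m ≤ d := by
  obtain ⟨T, rfl⟩ := hfstar
  choose S hS using fun i => (h i).1
  obtain rfl : (fun i => parity (S i)) = f := funext hS
  have hne : ∀ i, parity (S i) (x i) ≠ parity T (x i) := by
    intro i hi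
    have := (h i).2.1
    simp only [hi, sub_self, abs_zero] at this
    linarith
  -- Two distinct values `±1` are at distance `2 > ε`, too far for the sum-of-squares budget.
  have heq : ∀ i j, j < i → parity (S i) (x j) = parity T (x j) := by
    intro i j hji
    by_contra hij
    have hsq : ∀ l : Fin m, parity (S i) (x l) ≠ parity T (x l) →
        (parity (S i) (x l) - parity T (x l)) ^ 2 = 4 := by
      intro l hl
      rcases parity_eq_or (S i) (x l) with h1 | h1 <;>
        rcases parity_eq_or T (x l) with h2 | h2 <;> simp [h1, h2] at hl ⊢ <;> norm_num
    have hεlt : ε ^ 2 < 4 := by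
      rw [← hsq i (hne i), ← sq_abs (parity (S i) (x i) - _)]
      exact pow_lt_pow_left₀ (h i).2.1 hε two_ne_zero
    have hle : (parity (S i) (x j) - parity T (x j)) ^ 2 ≤ ε ^ 2 :=
      le_trans (Finset.single_le_sum
        (f := fun l => (parity (S i) (x l) - parity T (x l)) ^ 2)
        (fun l _ => sq_nonneg _) (by simpa using hji)) (h i).2.2
    rw [hsq j hij] at hle
    linarith
  let B : Matrix (Fin m) (Fin d) (ZMod 2) :=
    .of fun i c => (if c ∈ S i then 1 else 0) + (if c ∈ T then 1 else 0)
  let D : Matrix (Fin d) (Fin m) (ZMod 2) := .of fun c j => unitBit (x j c)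
  have hBD : ∀ i j, (B * D) i j = 0 ↔ parity (S i) (x j) = parity T (x j) := fun i j => by
    rw [parity_eq_parity_iff]; rfl
  have hdet : (B * D).det = 1 := by
    rw [Matrix.det_of_isUpperTriangular fun i j hij => (hBD i j).2 (heq i j hij)]
    refine Finset.prod_eq_one fun i _ => ?_
    have h01 : ∀ z : ZMod 2, z ≠ 0 → z = 1 := by decide
    exact h01 _ fun h0 => hne i ((hBD i i).1 h0)
  have hrank : (B * D).rank = m := by
    rw [Matrix.rank_of_isUnit _ ((Matrix.isUnit_iff_isUnit_det _).2 (by simp [hdet]))]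
    simp
  calc m = (B * D).rank := hrank.symm
    _ ≤ B.rank := Matrix.rank_mul_le_left B D
    _ ≤ d := B.rank_le_width

theorem exactEluderDimAt_parityClass_le {d : ℕ} {fstar : (Fin d → ℤˣ) → ℝ}
    (hfstar : fstar ∈ parityClass d) {ε : ℝ} (hε : 0 ≤ ε) :
    exactEluderDimAt (parityClass d) fstar ε ≤ d := by
  refine sSup_le ?_
  rintro _ ⟨m, rfl, x, f, h⟩
  exact_mod_cast le_of_isEluderSeq_parityClass hfstar hε h

/-! ### Orthogonality of parities -/

theorem sum_parity_mul_parity {d : ℕ} (x y : Fin d → ℤˣ) :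
    ∑ S : Finset (Fin d), parity S x * parity S y = if x = y then 2 ^ d else 0 := by
  have h : ∑ S : Finset (Fin d), parity S x * parity S y =
      ∏ i, (1 + ((x i : ℤ) : ℝ) * ((y i : ℤ) : ℝ)) := by
    rw [Finset.prod_one_add, Finset.powerset_univ]
    simp [parity, Finset.prod_mul_distrib]
  rw [h]
  split_ifs with hxy
  · subst hxy
    have : ∀ i, (1 + ((x i : ℤ) : ℝ) * ((x i : ℤ) : ℝ)) = 2 := by
      intro i
      rcases Int.units_eq_one_or (x i) with h | h <;> rw [h] <;> norm_num
    simp [this]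
  · obtain ⟨i, hi⟩ := Function.ne_iff.mp hxy
    refine Finset.prod_eq_zero (Finset.mem_univ i) ?_
    rcases Int.units_eq_one_or (x i) with h1 | h1 <;>
      rcases Int.units_eq_one_or (y i) with h2 | h2 <;> rw [h1, h2] at hi ⊢ <;> simp at hi ⊢

/-- The parity matrix is a Hadamard matrix: it scales squared Euclidean norms by `2 ^ d`. -/
theorem sum_sq_sum_parity_mul {d : ℕ} (z : (Fin d → ℤˣ) → ℝ) :
    ∑ S : Finset (Fin d), (∑ x, parity S x * z x) ^ 2 = 2 ^ d * ∑ x, z x ^ 2 := by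
  calc ∑ S : Finset (Fin d), (∑ x, parity S x * z x) ^ 2
      = ∑ S : Finset (Fin d), ∑ x, ∑ y, parity S x * parity S y * (z x * z y) := by
        refine Finset.sum_congr rfl fun S _ => ?_
        rw [sq, Finset.sum_mul_sum]
        exact Finset.sum_congr rfl fun x _ => Finset.sum_congr rfl fun y _ => by ring
    _ = ∑ x, ∑ y, (∑ S : Finset (Fin d), parity S x * parity S y) * (z x * z y) := by
        rw [Finset.sum_comm]
        refine Finset.sum_congr rfl fun x _ => ?_
        rw [Finset.sum_comm]
        exact Finset.sum_congr rfl fun y _ => by rw [Finset.sum_mul]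
    _ = 2 ^ d * ∑ x, z x ^ 2 := by
        simp [sum_parity_mul_parity, ite_mul, Finset.mul_sum, sq]

/-! ### The rank of the parities -/

theorem exists_threshold {ι : Type*} [Finite ι] (z : ι → ℝ) (P : ι → Prop)
    (h : ∀ i j, ¬ P i → P j → z i < z j) :
    ∃ θ : ℝ, ∀ i, (P i → θ < z i) ∧ (¬ P i → z i < θ) := by
  obtain ⟨θ, hlo, hhi⟩ := Order.exists_between_finsets
    (Set.toFinite (z '' {i | ¬ P i})).toFinset (Set.toFinite (z '' {i | P i})).toFinset (by
      simp only [Set.Finite.mem_toFinset]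
      rintro _ ⟨i, hi, rfl⟩ _ ⟨j, hj, rfl⟩
      exact h i j hi hj)
  simp only [Set.Finite.mem_toFinset] at hlo hhi
  exact ⟨θ, fun i => ⟨fun hi => hhi _ ⟨i, hi, rfl⟩, fun hi => hlo _ ⟨i, hi, rfl⟩⟩⟩

/-- A realization of the parities in dimension `k` through a monotone activation is a sign
representation of the parity matrix in dimension `k + 1`. -/
theorem two_pow_le_sq_of_isRealizable {d k : ℕ} {σ : ℝ → ℝ} (hσ : Monotone σ) {R : ℝ}
    (h : IsRealizable σ (parityClass d) R k) : (2 : ℝ) ^ d ≤ ((k : ℝ) + 1) ^ 2 := by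
  classical
  obtain ⟨φ, w, hφw⟩ := h
  let W : Finset (Fin d) → EuclideanSpace ℝ (Fin k) := fun S => w ⟨parity S, S, rfl⟩
  let z : (Fin d → ℤˣ) → Finset (Fin d) → ℝ := fun x S =>
    inner ℝ (W S) (φ x : EuclideanSpace ℝ (Fin k))
  have hz : ∀ x S, parity S x = σ (z x S) := fun x S => hφw x ⟨parity S, S, rfl⟩
  obtain ⟨θ, hθ⟩ := exists_threshold
    (fun q : (Fin d → ℤˣ) × Finset (Fin d) => z q.1 q.2) (fun q => parity q.2 q.1 = 1) <| by
    intro q q' hq hq'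
    have hq1 : parity q.2 q.1 = -1 := (parity_eq_or q.2 q.1).resolve_left hq
    refine hσ.reflect_lt ?_
    rw [← hz, ← hz, hq1, hq']
    norm_num
  -- The constant coordinate absorbs the threshold `θ`.
  let a : (Fin d → ℤˣ) → Fin (k + 1) → ℝ := fun x =>
    Fin.cons (-1) fun i => (φ x : EuclideanSpace ℝ (Fin k)) i
  let b : Finset (Fin d) → Fin (k + 1) → ℝ := fun S => Fin.cons θ fun i => W S i
  have hab : ∀ x S, a x ⬝ᵥ b S = z x S - θ := by
    intro x S
    simp only [dotProduct, Fin.sum_univ_succ, a, b, z, PiLp.inner_apply, Fin.cons_zero,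
      Fin.cons_succ, RCLike.inner_apply, conj_trivial]
    ring
  have hsign : ∀ x S, 0 < parity S x * (a x ⬝ᵥ b S) := by
    intro x S
    rw [hab]
    by_cases h1 : parity S x = 1
    · have := (hθ (x, S)).1 h1
      rw [h1, one_mul]
      exact sub_pos.2 this
    · have := (hθ (x, S)).2 h1
      rw [(parity_eq_or S x).resolve_left h1, neg_one_mul, neg_pos]
      exact sub_neg.2 this
  have hF := forster (M := fun x S => parity S x) (C := 2 ^ d)
    (fun x S => by rcases parity_eq_or S x with h1 | h1 <;> simp [h1])
    (fun z => (sum_sq_sum_parity_mul z).le) hsign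
  have hcard : (Fintype.card (Fin d → ℤˣ) : ℝ) = 2 ^ d := by simp
  have hcard' : (Fintype.card (Finset (Fin d)) : ℝ) = 2 ^ d := by simp
  rw [hcard, hcard'] at hF
  have := le_of_mul_le_mul_left hF (by positivity)
  exact_mod_cast this

theorem le_sigmaRank_parityClass {d : ℕ} {σ : ℝ → ℝ} (hσ : Monotone σ) (R : ℝ) :
    (⌈(2 : ℝ) ^ ((d : ℝ) / 2) - 1⌉₊ : ℕ∞) ≤ sigmaRank σ (parityClass d) R := by
  refine le_sInf ?_
  rintro _ ⟨k, rfl, hk⟩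
  have h := two_pow_le_sq_of_isRealizable hσ hk
  have hsq : ((2 : ℝ) ^ ((d : ℝ) / 2)) ^ 2 = 2 ^ d := by
    rw [← Real.rpow_natCast, ← Real.rpow_mul (by norm_num), ← Real.rpow_natCast]
    norm_num
  rw [← hsq] at h
  have := le_of_sq_le_sq h (by positivity)
  refine Nat.cast_le.2 (Nat.ceil_le.2 ?_)
  linarith

theorem ofReal_le_toENNReal_of_natCeil_le {r : ℝ} {n : ℕ∞} (h : (⌈r⌉₊ : ℕ∞) ≤ n) :
    ENNReal.ofReal r ≤ (n : ℝ≥0∞) := by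
  calc ENNReal.ofReal r ≤ ENNReal.ofReal (⌈r⌉₊ : ℝ) := ENNReal.ofReal_le_ofReal (Nat.le_ceil r)
    _ = ((⌈r⌉₊ : ℕ∞) : ℝ≥0∞) := by simp
    _ ≤ n := ENat.toENNReal_le.2 h

theorem monotone_of_mem_monotoneActivations {L : ℝ} {σ : ℝ → ℝ}
    (hσ : σ ∈ monotoneActivations 0 L) : Monotone σ := by
  refine monotone_iff_forall_lt.2 fun z z' hz => ?_
  have h := (hσ z z' hz).1
  have h1 : 0 < z' - z := sub_pos.2 hz
  have := mul_nonneg h h1.le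
  rw [div_mul_cancel₀ _ h1.ne'] at this
  linarith

end EluderRank

theorem mainTheorem2 (d : ℕ) :
    (∀ R : ℝ, 0 < R →
      ENNReal.ofReal ((2 : ℝ) ^ ((d : ℝ) / 2) - 1) ≤
        ((EluderRank.activationRank (EluderRank.monotoneActivations 0 1)
          (EluderRank.parityClass d) R : ℕ∞) : ℝ≥0∞)) ∧
    (∀ ε : ℝ, 0 ≤ ε →
      EluderRank.exactStarNum (EluderRank.parityClass d) ε ≤
          EluderRank.exactEluderDim (EluderRank.parityClass d) ε ∧
        EluderRank.exactEluderDim (EluderRank.parityClass d) ε ≤ (d : ℕ∞)) ∧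
    (∀ σ : ℝ → ℝ, Monotone σ → ∀ R : ℝ, 0 < R → ∀ ε : ℝ, 0 < ε →
      EluderRank.eluderDim (EluderRank.parityClass d) ε ≤ (d : ℕ∞) ∧
        ENNReal.ofReal ((2 : ℝ) ^ ((d : ℝ) / 2) - 1) ≤
          ((EluderRank.sigmaRank σ (EluderRank.parityClass d) R : ℕ∞) : ℝ≥0∞)) := by
  refine ⟨fun R _ => ?_, fun ε hε => ⟨EluderRank.exactStarNum_le_exactEluderDim _ _, ?_⟩,
    fun σ hσ R _ ε hε => ⟨?_, ?_⟩⟩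
  · exact EluderRank.ofReal_le_toENNReal_of_natCeil_le (le_iInf₂ fun σ hσ =>
      EluderRank.le_sigmaRank_parityClass (EluderRank.monotone_of_mem_monotoneActivations hσ) R)
  · exact iSup₂_le fun fstar hf => EluderRank.exactEluderDimAt_parityClass_le hf hε
  · exact iSup₂_le fun fstar hf => iSup₂_le fun ε' hε' =>
      EluderRank.exactEluderDimAt_parityClass_le hf (hε.le.trans hε')
  · exact EluderRank.ofReal_le_toENNReal_of_natCeil_le (EluderRank.le_sigmaRank_parityClass hσ R)
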